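/- Let $N\in\mathbb N$, let $\Sigma\in\mathbb R^{N\times N}$ be symmetric positive definite, and let $$\phi(x)=(2\pi)^{-N/2}(\det\Sigma)^{-1/2}\exp\left(-\tfrac12 x^{T}\Sigma^{-1}x\right),\qquad x\in\mathbb R^N,$$ be the density of a Gaussian random vector $X$ with mean zero and covariance matrix $\Sigma$. For a multi-index $j=(j_1,\dots,j_N)\in\mathbb N_0^N$ with $|j|=j_1+\dots+j_N$ define the multivariate Hermite polynomial $$H_j(x)=\frac{(-1)^{|j|}}{\phi(x)}\,\frac{\partial^{|j|}\phi}{\partial x_1^{j_1}\cdots\partial x_N^{j_N}}(x).$$ For $l\in\mathbb N_0$ let $\mathcal V_l^N$ be the space of real polynomials $P$ on $\mathbb R^N$ of total degree at most $l$ such that $\int_{\mathbb R^N}P\,Q\,\phi\,dx=0$ for all polynomials $Q$ of total degree less than $l$ (so $\mathcal V_0^N$ consists of the constants). Then: (a) for every $l\in\mathbb N_0$ the family $\{H_j:|j|=l\}$ is linearly independent and spans $\mathcal V_l^N$, that is, it is a basis of $\mathcal V_l^N$; for $k\neq l$ the spans of $\{H_j:|j|=k\}$ and $\{H_j:|j|=l\}$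 are orthogonal with respect to the inner product $\int_{\mathbb R^N}P\,Q\,\phi\,dx$, and the sum of these spans over all $l$ is the space $\mathbb R[x_1,\dots,x_N]$ of all polynomials; (b) the orthogonal sum $\bigoplus_{l\in\mathbb N_0}\operatorname{span}\{H_j:|j|=l\}$ is dense in the real Hilbert space $L^2(\mathbb R^N,\mathcal B^N,\phi\,dx)$; (c) $L^2(\mathbb R^N,\mathcal B^N,\phi\,dx)=\overline{\bigoplus_{l\in\mathbb N_0}\mathcal V_l^N}$, where the overline denotes closure in $L^2$. -/

import Mathlib

open MeasureTheory
open scoped Matrix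

noncomputable section

namespace GaussianHermite

variable {N : ℕ}

/-- The density `φ(x; S)` of the centred Gaussian distribution on `ℝ^N` with covariance `S`. -/
def density (S : Matrix (Fin N) (Fin N) ℝ) (x : Fin N → ℝ) : ℝ :=
  (2 * Real.pi) ^ (-(N : ℝ) / 2) * S.det ^ (-(1 : ℝ) / 2) *
    Real.exp (-(1 / 2) * (x ⬝ᵥ (S⁻¹ *ᵥ x)))

/-- The Gaussian measure `φ(x; S) dx` on the Borel sets of `ℝ^N`. -/
def gaussian (S : Matrix (Fin N) (Fin N) ℝ) : Measure (Fin N → ℝ) :=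
  volume.withDensity (fun x => ENNReal.ofReal (density S x))

/-- The degree `|j| = j_1 + ⋯ + j_N` of a multi-index. -/
def degree (j : Fin N → ℕ) : ℕ := ∑ i, j i

/-- The monomial function `x ↦ x_1 ^ j_1 ⋯ x_N ^ j_N`. -/
def monomial (j : Fin N → ℕ) : (Fin N → ℝ) → ℝ := fun x => ∏ i, x i ^ j i

/-- The real polynomial functions on `ℝ^N` of total degree at most `m`. -/
def polyLE (N m : ℕ) : Submodule ℝ ((Fin N → ℝ) → ℝ) :=
  Submodule.span ℝ {f | ∃ j : Fin N → ℕ, degree j ≤ m ∧ f = monomial j}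

/-- All real polynomial functions on `ℝ^N`. -/
def poly (N : ℕ) : Submodule ℝ ((Fin N → ℝ) → ℝ) :=
  Submodule.span ℝ (Set.range (monomial (N := N)))

/-- The partial derivative `∂f / ∂x_i`. -/
def partialDeriv (i : Fin N) (f : (Fin N → ℝ) → ℝ) : (Fin N → ℝ) → ℝ :=
  fun x => lineDeriv ℝ f x (Pi.single i 1)

/-- The mixed partial derivative `∂^{|j|} f / ∂x_1^{j_1} ⋯ ∂x_N^{j_N}`. -/
def mixedDeriv (j : Fin N → ℕ) (f : (Fin N → ℝ) → ℝ) : (Fin N → ℝ) → ℝ :=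
  (List.finRange N).foldr (fun i g => (partialDeriv i)^[j i] g) f

/-- The multivariate Hermite polynomial `H_j(x; S) = (-1)^|j| φ(x; S)⁻¹ ∂^j φ(x; S)`. -/
def hermite (S : Matrix (Fin N) (Fin N) ℝ) (j : Fin N → ℕ) : (Fin N → ℝ) → ℝ :=
  fun x => (-1) ^ degree j / density S x * mixedDeriv j (density S) x

/-- The span of the Hermite polynomials `H_j(·; S)` with `|j| = l`. -/
def hermiteSpan (S : Matrix (Fin N) (Fin N) ℝ) (l : ℕ) : Submodule ℝ ((Fin N → ℝ) → ℝ) :=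
  Submodule.span ℝ (Set.range fun j : {j : Fin N → ℕ // degree j = l} => hermite S j)

theorem quadForm_lower {S : Matrix (Fin N) (Fin N) ℝ} (hS : S.PosDef) :
    ∃ c : ℝ, 0 < c ∧ ∀ x : Fin N → ℝ, c * ∑ i, x i ^ 2 ≤ x ⬝ᵥ (S⁻¹ *ᵥ x) := by
  have hpos : ∀ x : Fin N → ℝ, x ≠ 0 → 0 < x ⬝ᵥ (S⁻¹ *ᵥ x) := fun x hx => by
    simpa using hS.inv.dotProduct_mulVec_pos hx
  rcases Nat.eq_zero_or_pos N with rfl | hN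
  · exact ⟨1, one_pos, fun x => by simp [dotProduct]⟩
  have : Nonempty (Fin N) := ⟨⟨0, hN⟩⟩
  have hcont : Continuous fun x : Fin N → ℝ => x ⬝ᵥ (S⁻¹ *ᵥ x) := by fun_prop
  obtain ⟨y, hy, hmin⟩ := (isCompact_sphere (0 : Fin N → ℝ) 1).exists_isMinOn
    (NormedSpace.sphere_nonempty.2 zero_le_one) hcont.continuousOn
  have hy0 : y ≠ 0 := by
    rintro rfl
    simp at hy
  have hm := hpos y hy0
  have hN' : (0 : ℝ) < N := by exact_mod_cast hN
  refine ⟨(y ⬝ᵥ (S⁻¹ *ᵥ y)) / N, div_pos hm hN', fun x => ?_⟩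
  rcases eq_or_ne x 0 with rfl | hx
  · simp
  have hn : 0 < ‖x‖ := norm_pos_iff.2 hx
  have h1 : y ⬝ᵥ (S⁻¹ *ᵥ y) ≤ (‖x‖⁻¹ • x) ⬝ᵥ (S⁻¹ *ᵥ (‖x‖⁻¹ • x)) := by
    apply hmin
    simp [norm_smul, hn.ne']
  rw [Matrix.mulVec_smul, smul_dotProduct, dotProduct_smul, smul_eq_mul, smul_eq_mul] at h1
  have h2 : ∑ i, x i ^ 2 ≤ N * ‖x‖ ^ 2 := by
    calc ∑ i, x i ^ 2 ≤ ∑ _i : Fin N, ‖x‖ ^ 2 := by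
          refine Finset.sum_le_sum fun i _ => ?_
          rw [← sq_abs]
          exact pow_le_pow_left₀ (abs_nonneg _) (norm_le_pi_norm x i) 2
      _ = N * ‖x‖ ^ 2 := by simp
  have h3 : (y ⬝ᵥ (S⁻¹ *ᵥ y)) * ‖x‖ ^ 2 ≤ x ⬝ᵥ (S⁻¹ *ᵥ x) := by
    have := mul_le_mul_of_nonneg_right h1 (sq_nonneg ‖x‖)
    refine this.trans (le_of_eq ?_)
    field_simp
  calc (y ⬝ᵥ (S⁻¹ *ᵥ y)) / N * ∑ i, x i ^ 2
      ≤ (y ⬝ᵥ (S⁻¹ *ᵥ y)) / N * (N * ‖x‖ ^ 2) := by gcongr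
    _ = (y ⬝ᵥ (S⁻¹ *ᵥ y)) * ‖x‖ ^ 2 := by field_simp
    _ ≤ _ := h3

theorem continuous_density (S : Matrix (Fin N) (Fin N) ℝ) : Continuous (density S) := by
  unfold density
  fun_prop

theorem density_nonneg {S : Matrix (Fin N) (Fin N) ℝ} (hS : S.PosDef) (x : Fin N → ℝ) :
    0 ≤ density S x := by
  have := hS.det_pos
  unfold density
  positivity

theorem continuous_monomial (j : Fin N → ℕ) : Continuous (monomial j) := by
  unfold monomial
  fun_prop

/-- Monomials are square integrable with respect to a nondegenerate Gaussian measure. -/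
theorem memLp_monomial {S : Matrix (Fin N) (Fin N) ℝ} (hS : S.PosDef) (j : Fin N → ℕ) :
    MemLp (monomial j) 2 (gaussian S) := by
  rw [memLp_two_iff_integrable_sq (continuous_monomial j).aestronglyMeasurable]
  unfold gaussian
  rw [integrable_withDensity_iff (continuous_density S).measurable.ennreal_ofReal (by simp)]
  obtain ⟨c, hc, hq⟩ := quadForm_lower hS
  have hdet := hS.det_pos
  set K : ℝ := (2 * Real.pi) ^ (-(N : ℝ) / 2) * S.det ^ (-(1 : ℝ) / 2) with hK
  have hK0 : 0 ≤ K := by positivity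
  have h1 : Integrable fun x : Fin N → ℝ =>
      K * ∏ i, (x i ^ (2 * j i) * Real.exp (-(c / 2) * x i ^ 2)) := by
    refine Integrable.const_mul ?_ K
    refine Integrable.fintype_prod (f := fun i (t : ℝ) =>
      t ^ (2 * j i) * Real.exp (-(c / 2) * t ^ 2)) fun i => ?_
    have := integrable_rpow_mul_exp_neg_mul_sq (b := c / 2) (by positivity)
      (s := ((2 * j i : ℕ) : ℝ)) (by
        have : (0 : ℝ) ≤ ((2 * j i : ℕ) : ℝ) := Nat.cast_nonneg _
        linarith)
    simpa only [Real.rpow_natCast] using this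
  refine h1.mono' ?_ (Filter.Eventually.of_forall fun x => ?_)
  · exact ((continuous_monomial j).pow 2).aestronglyMeasurable.mul
      (continuous_density S).measurable.ennreal_ofReal.ennreal_toReal.aestronglyMeasurable
  · rw [ENNReal.toReal_ofReal (density_nonneg hS x), Real.norm_of_nonneg
      (mul_nonneg (sq_nonneg _) (density_nonneg hS x)), Finset.prod_mul_distrib,
      ← Real.exp_sum, ← Finset.mul_sum]
    have e1 : monomial j x ^ 2 = ∏ i, x i ^ (2 * j i) := by
      unfold monomial
      rw [← Finset.prod_pow]
      exact Finset.prod_congr rfl fun i _ => by rw [← pow_mul, mul_comm]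
    have e2 : density S x ≤ K * Real.exp (-(c / 2) * ∑ i, x i ^ 2) := by
      unfold density
      rw [← hK]
      refine mul_le_mul_of_nonneg_left (Real.exp_le_exp.2 ?_) hK0
      have := hq x
      linarith
    rw [← e1]
    calc monomial j x ^ 2 * density S x
        ≤ monomial j x ^ 2 * (K * Real.exp (-(c / 2) * ∑ i, x i ^ 2)) :=
          mul_le_mul_of_nonneg_left e2 (sq_nonneg _)
      _ = _ := by ring

/-- Polynomials are square integrable with respect to a nondegenerate Gaussian measure. -/
theorem memLp_poly {S : Matrix (Fin N) (Fin N) ℝ} (hS : S.PosDef)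
    {f : (Fin N → ℝ) → ℝ} (hf : f ∈ poly N) : MemLp f 2 (gaussian S) := by
  unfold poly at hf
  induction hf using Submodule.span_induction with
  | mem f h =>
    obtain ⟨j, rfl⟩ := h
    exact memLp_monomial hS j
  | zero => exact MemLp.zero
  | add f g _ _ h1 h2 => exact h1.add h2
  | smul a f _ h => exact h.const_smul a

theorem polyLE_le_poly (N m : ℕ) : polyLE N m ≤ poly N := by
  refine Submodule.span_mono ?_
  rintro _ ⟨j, -, rfl⟩
  exact ⟨j, rfl⟩

/-- The space of orthogonal polynomials of degree `l`: the polynomials of degree at most `l` that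
are orthogonal in `L²(φ dx)` to all polynomials of degree less than `l`
(for `l = 0`, all constants). -/
def orthPoly {S : Matrix (Fin N) (Fin N) ℝ} (hS : S.PosDef) (l : ℕ) :
    Submodule ℝ ((Fin N → ℝ) → ℝ) where
  carrier := {f | f ∈ polyLE N l ∧
    ∀ m < l, ∀ g ∈ polyLE N m, ∫ x, f x * g x ∂(gaussian S) = 0}
  zero_mem' := ⟨Submodule.zero_mem _, fun m _ g _ => by simp⟩
  add_mem' := by
    rintro f₁ f₂ ⟨h1, h1'⟩ ⟨h2, h2'⟩
    refine ⟨Submodule.add_mem _ h1 h2, fun m hm g hg => ?_⟩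
    have hgL := memLp_poly hS (polyLE_le_poly N m hg)
    have i1 := (memLp_poly hS (polyLE_le_poly N l h1)).integrable_mul hgL
    have i2 := (memLp_poly hS (polyLE_le_poly N l h2)).integrable_mul hgL
    have e := integral_add i1 i2
    simp only [Pi.mul_apply] at e
    simp only [Pi.add_apply, add_mul]
    rw [e, h1' m hm g hg, h2' m hm g hg, add_zero]
  smul_mem' := by
    rintro a f ⟨h, h'⟩
    refine ⟨Submodule.smul_mem _ a h, fun m hm g hg => ?_⟩
    simp only [Pi.smul_apply, smul_eq_mul, mul_assoc]
    rw [integral_const_mul, h' m hm g hg, mul_zero]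

/-- The subspace of `L²(ℝ^N, φ dx)` formed by the classes of the square integrable members of a
linear space of functions. -/
def l2Classes (S : Matrix (Fin N) (Fin N) ℝ) (W : Submodule ℝ ((Fin N → ℝ) → ℝ)) :
    Submodule ℝ (Lp ℝ 2 (gaussian S)) where
  carrier := {F | ∃ f ∈ W, F =ᵐ[gaussian S] f}
  zero_mem' := ⟨0, W.zero_mem, Lp.coeFn_zero _ _ _⟩
  add_mem' := by
    rintro F G ⟨f, hf, hF⟩ ⟨g, hg, hG⟩
    exact ⟨f + g, W.add_mem hf hg, (Lp.coeFn_add F G).trans (hF.add hG)⟩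
  smul_mem' := by
    rintro a F ⟨f, hf, hF⟩
    exact ⟨a • f, W.smul_mem a hf, (Lp.coeFn_smul a F).trans (hF.const_smul a)⟩

end GaussianHermite

end

/-! Everything follows from one adjointness relation. Let `A_i q = (S⁻¹ x)_i q - ∂_i q`. Since `∂_i
φ = -(S⁻¹ x)_i φ`, the product rule gives `∂_i (φ q) = -φ (A_i q)`, so `H_j` is the constant 1
raised `j_i` times by each `A_i`, a polynomial of degree at most `|j|`. Integration by parts makes
`A_i` the adjoint of `∂_i` in `L²(φ dx)`, hence `∫ x^k H_j φ = ∫ (∂^j x^k) φ`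
(`integral_monomial_mul_hermite`). For `|k| ≤ |j|` this vanishes unless `k = j`, when it is `j!`
times the nonzero total mass.

Thus the monomials of degree `l` are biorthogonal, up to nonzero factors, to the `H_j` of degree
`l`, which are also orthogonal to all lower degrees. This replaces orthogonality among the `H_j` of
equal degree, which fails in general. It gives independence, and it allows the pairings with
monomials to be removed degree by degree by subtracting Hermite polynomials
(`exists_hermiteSpan_sub_orthogonal`). Once a remainder of degree at most `l` is orthogonal to
degree at most `l`, it is orthogonal to itself, so zero.

For density, let `f` in `L²` be orthogonal to all polynomials. As `exp |L x|` is in `L²` for every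
linear form `L`, the series of `exp (i L x)` may be integrated termwise against `f`, giving 0. The
positive and negative parts of `f` then define measures with the same characteristic function, so `f
= 0` almost everywhere. -/

noncomputable section

namespace GaussianHermite

variable {N : ℕ}

/-! ### Polynomial functions -/

/-- The polynomial function on `ℝ^N` of a multivariate polynomial. -/
def evalFun : MvPolynomial (Fin N) ℝ →ₗ[ℝ] ((Fin N → ℝ) → ℝ) where
  toFun p x := MvPolynomial.eval x p
  map_add' p q := by ext; simp
  map_smul' a p := by ext; simp

@[simp]
theorem evalFun_apply (p : MvPolynomial (Fin N) ℝ) (x : Fin N → ℝ) :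
    evalFun p x = MvPolynomial.eval x p := rfl

theorem continuous_evalFun (p : MvPolynomial (Fin N) ℝ) : Continuous (evalFun p) :=
  MvPolynomial.continuous_eval p

theorem evalFun_monomial (k : Fin N →₀ ℕ) (c : ℝ) :
    evalFun (MvPolynomial.monomial k c) = c • monomial ⇑k := by
  ext x
  simp [MvPolynomial.eval_monomial, monomial, Finsupp.prod_fintype]

theorem evalFun_mem_polyLE {p : MvPolynomial (Fin N) ℝ} {m : ℕ} (hp : p.totalDegree ≤ m) :
    evalFun p ∈ polyLE N m := by
  rw [p.as_sum, map_sum]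
  refine Submodule.sum_mem _ fun k hk => ?_
  rw [evalFun_monomial]
  refine Submodule.smul_mem _ _ (Submodule.subset_span ⟨⇑k, ?_, rfl⟩)
  refine le_trans ?_ ((MvPolynomial.le_totalDegree hk).trans hp)
  simp [degree, Finsupp.sum_fintype]

theorem evalFun_mem_poly (p : MvPolynomial (Fin N) ℝ) : evalFun p ∈ poly N :=
  polyLE_le_poly N _ (evalFun_mem_polyLE le_rfl)

theorem exists_evalFun_eq {f : (Fin N → ℝ) → ℝ} (hf : f ∈ poly N) : ∃ p, evalFun p = f := by
  have h : poly N ≤ LinearMap.range (evalFun (N := N)) := by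
    refine Submodule.span_le.2 ?_
    rintro _ ⟨j, rfl⟩
    exact ⟨MvPolynomial.monomial (Finsupp.equivFunOnFinite.symm j) 1, by
      rw [evalFun_monomial]; simp⟩
  exact h hf

theorem polyLE_mono {m n : ℕ} (h : m ≤ n) : polyLE N m ≤ polyLE N n := by
  refine Submodule.span_mono ?_
  rintro _ ⟨j, hj, rfl⟩
  exact ⟨j, hj.trans h, rfl⟩

theorem exists_mem_polyLE {f : (Fin N → ℝ) → ℝ} (hf : f ∈ poly N) : ∃ m, f ∈ polyLE N m := by
  obtain ⟨p, rfl⟩ := exists_evalFun_eq hf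
  exact ⟨_, evalFun_mem_polyLE le_rfl⟩

theorem totalDegree_pderiv_le (i : Fin N) (p : MvPolynomial (Fin N) ℝ) :
    (MvPolynomial.pderiv i p).totalDegree ≤ p.totalDegree := by
  refine Finset.sup_le fun m hm => ?_
  rw [MvPolynomial.mem_support_iff, MvPolynomial.coeff_pderiv] at hm
  have h := MvPolynomial.le_totalDegree (MvPolynomial.mem_support_iff.2 (left_ne_zero_of_mul hm))
  rw [Finsupp.sum_add_index' (by simp) (by simp)] at h
  exact (Nat.le_add_right _ _).trans h

/-- The truncated exponent is harmless: when `n > k i` the descending factorial is 0. -/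
theorem iterate_pderiv_monomial (i : Fin N) (n : ℕ) (k : Fin N →₀ ℕ) (c : ℝ) :
    (MvPolynomial.pderiv i)^[n] (MvPolynomial.monomial k c) =
      MvPolynomial.monomial (k - Finsupp.single i n) (c * (k i).descFactorial n) := by
  induction n with
  | zero => simp
  | succ n ih =>
    rw [Function.iterate_succ_apply', ih, MvPolynomial.pderiv_monomial, tsub_tsub,
      ← Finsupp.single_add, Nat.descFactorial_succ]
    simp
    ring_nf

/-- Without repeated indices, differentiating in one variable leaves the other exponents intact, so
each factor involves the original `k i`. -/
theorem foldl_pderiv_monomial (j : Fin N → ℕ) (s : List (Fin N)) (hs : s.Nodup)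
    (k : Fin N →₀ ℕ) (c : ℝ) :
    s.foldl (fun p i => (MvPolynomial.pderiv i)^[j i] p) (MvPolynomial.monomial k c) =
      MvPolynomial.monomial (k - (s.map fun i => Finsupp.single i (j i)).sum)
        (c * (s.map fun i => ((k i).descFactorial (j i) : ℝ)).prod) := by
  induction s generalizing k c with
  | nil => simp
  | cons i s ih =>
    rw [List.nodup_cons] at hs
    rw [List.foldl_cons, iterate_pderiv_monomial, ih hs.2, List.map_cons, List.sum_cons,
      List.map_cons, List.prod_cons, tsub_tsub, mul_assoc]
    congr 4
    refine List.map_congr_left fun a ha => ?_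
    have : i ≠ a := by rintro rfl; exact hs.1 ha
    simp [this]

theorem hasLineDerivAt_evalFun (p : MvPolynomial (Fin N) ℝ) (i : Fin N) (x : Fin N → ℝ) :
    HasLineDerivAt ℝ (evalFun p) (evalFun (MvPolynomial.pderiv i p) x) x (Pi.single i 1) := by
  unfold HasLineDerivAt
  induction p using MvPolynomial.induction_on with
  | C a => simpa using hasDerivAt_const (0 : ℝ) a
  | add p q hp hq =>
    simp only [map_add, Pi.add_apply]
    exact hp.add hq
  | mul_X p k hp =>
    have hx : HasDerivAt (fun t : ℝ => (x + t • (Pi.single i 1 : Fin N → ℝ)) k)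
        ((Pi.single i 1 : Fin N → ℝ) k) 0 := by
      simpa using ((hasDerivAt_id (0 : ℝ)).mul_const ((Pi.single i 1 : Fin N → ℝ) k)).const_add
        (x k)
    refine (hp.mul hx).congr_deriv ?_ |>.congr_of_eventuallyEq ?_
    · by_cases h : k = i
      · subst h
        simp
        ring
      · simp [MvPolynomial.pderiv_X, h]
        ring
    · exact Filter.Eventually.of_forall fun t => by simp

/-! ### Derivatives of the density -/

/-- The linear form `x ↦ (S⁻¹ x)_i`. -/
def precisionForm (S : Matrix (Fin N) (Fin N) ℝ) (i : Fin N) : MvPolynomial (Fin N) ℝ :=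
  ∑ k, MvPolynomial.C (S⁻¹ i k) * MvPolynomial.X k

theorem eval_precisionForm (S : Matrix (Fin N) (Fin N) ℝ) (i : Fin N) (x : Fin N → ℝ) :
    MvPolynomial.eval x (precisionForm S i) = (S⁻¹ *ᵥ x) i := by
  simp [precisionForm, Matrix.mulVec, dotProduct]

theorem totalDegree_precisionForm_le (S : Matrix (Fin N) (Fin N) ℝ) (i : Fin N) :
    (precisionForm S i).totalDegree ≤ 1 := by
  refine (MvPolynomial.totalDegree_finsetSum _ _).trans (Finset.sup_le fun k _ => ?_)
  refine (MvPolynomial.totalDegree_mul _ _).trans ?_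
  simp

/-- The raising operator `q ↦ (S⁻¹ x)_i q - ∂_i q`, the adjoint of `∂_i` in `L²(φ dx)`. -/
def raising (S : Matrix (Fin N) (Fin N) ℝ) (i : Fin N) (q : MvPolynomial (Fin N) ℝ) :
    MvPolynomial (Fin N) ℝ :=
  precisionForm S i * q - MvPolynomial.pderiv i q

/-- The successive application of the raising operators of the indices in a list. -/
def raisingList (S : Matrix (Fin N) (Fin N) ℝ) (j : Fin N → ℕ) (s : List (Fin N)) :
    MvPolynomial (Fin N) ℝ :=
  s.foldr (fun i q => (raising S i)^[j i] q) 1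

theorem totalDegree_raising_le (S : Matrix (Fin N) (Fin N) ℝ) (i : Fin N)
    (q : MvPolynomial (Fin N) ℝ) : (raising S i q).totalDegree ≤ q.totalDegree + 1 := by
  refine (MvPolynomial.totalDegree_sub _ _).trans (max_le ?_ ?_)
  · refine (MvPolynomial.totalDegree_mul _ _).trans ?_
    have := totalDegree_precisionForm_le S i
    lia
  · exact (totalDegree_pderiv_le i q).trans (Nat.le_succ _)

theorem totalDegree_iterate_raising_le (S : Matrix (Fin N) (Fin N) ℝ) (i : Fin N) (n : ℕ)
    (q : MvPolynomial (Fin N) ℝ) : ((raising S i)^[n] q).totalDegree ≤ q.totalDegree + n := by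
  induction n with
  | zero => simp
  | succ n ih =>
    rw [Function.iterate_succ_apply']
    have := totalDegree_raising_le S i ((raising S i)^[n] q)
    lia

theorem totalDegree_raisingList_le (S : Matrix (Fin N) (Fin N) ℝ) (j : Fin N → ℕ)
    (s : List (Fin N)) : (raisingList S j s).totalDegree ≤ (s.map j).sum := by
  induction s with
  | nil => simp [raisingList]
  | cons i s ih =>
    have := totalDegree_iterate_raising_le S i (j i) (raisingList S j s)
    rw [raisingList] at this ⊢
    rw [raisingList] at ih
    simp only [List.foldr_cons, List.map_cons, List.sum_cons]
    lia

/-- On a coordinate line the exponent is a quadratic polynomial in `t`. Symmetry of `S⁻¹` merges the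
two cross terms, and the resulting 2 cancels the factor 1/2. -/
theorem hasLineDerivAt_density {S : Matrix (Fin N) (Fin N) ℝ} (hS : S.PosDef) (i : Fin N)
    (x : Fin N → ℝ) :
    HasLineDerivAt ℝ (density S) (-((S⁻¹ *ᵥ x) i * density S x)) x (Pi.single i 1) := by
  unfold HasLineDerivAt
  have hsymm : ∀ v w : Fin N → ℝ, v ⬝ᵥ (S⁻¹ *ᵥ w) = w ⬝ᵥ (S⁻¹ *ᵥ v) := fun v w => by
    have h : (S⁻¹)ᵀ = S⁻¹ := by simpa using hS.inv.isHermitian.eq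
    rw [Matrix.dotProduct_mulVec, ← Matrix.mulVec_transpose, h, dotProduct_comm]
  set e : Fin N → ℝ := Pi.single i 1
  have hq : (fun t : ℝ => (x + t • e) ⬝ᵥ (S⁻¹ *ᵥ (x + t • e))) = fun t : ℝ =>
      x ⬝ᵥ (S⁻¹ *ᵥ x) + 2 * (S⁻¹ *ᵥ x) i * t + (S⁻¹ *ᵥ e) i * t ^ 2 := by
    ext t
    have h1 : e ⬝ᵥ (S⁻¹ *ᵥ x) = (S⁻¹ *ᵥ x) i := by simp [e]
    have h2 : e ⬝ᵥ (S⁻¹ *ᵥ e) = (S⁻¹ *ᵥ e) i := by simp only [e, single_one_dotProduct]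
    simp only [Matrix.mulVec_add, Matrix.mulVec_smul, add_dotProduct, dotProduct_add,
      smul_dotProduct, dotProduct_smul, smul_eq_mul, hsymm x e, h1, h2]
    ring
  have hd : HasDerivAt (fun t : ℝ => (x + t • e) ⬝ᵥ (S⁻¹ *ᵥ (x + t • e)))
      (2 * (S⁻¹ *ᵥ x) i) 0 := by
    rw [hq]
    have h1 := ((hasDerivAt_id (0 : ℝ)).const_mul (2 * (S⁻¹ *ᵥ x) i)).const_add
      (x ⬝ᵥ (S⁻¹ *ᵥ x))
    have h2 := (hasDerivAt_pow 2 (0 : ℝ)).const_mul ((S⁻¹ *ᵥ e) i)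
    refine (h1.add h2).congr_deriv ?_
    simp
  have := ((hd.const_mul (-(1 / 2))).exp).const_mul
    ((2 * Real.pi) ^ (-(N : ℝ) / 2) * S.det ^ (-(1 : ℝ) / 2))
  refine this.congr_deriv ?_
  simp only [density, zero_smul, add_zero]
  ring

/-- Functions `c φ q` are stable under `∂_i`, which acts as `-A_i` on `q`. The scalar `c` is carried
along to collect the signs under iteration. -/
theorem partialDeriv_density_mul {S : Matrix (Fin N) (Fin N) ℝ} (hS : S.PosDef) (i : Fin N)
    (c : ℝ) (q : MvPolynomial (Fin N) ℝ) :
    partialDeriv i (fun x => c * (density S x * MvPolynomial.eval x q)) =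
      fun x => -c * (density S x * MvPolynomial.eval x (raising S i q)) := by
  ext x
  have h1 := hasLineDerivAt_density hS i x
  have h2 := hasLineDerivAt_evalFun q i x
  have h : HasLineDerivAt ℝ (fun x => c * (density S x * MvPolynomial.eval x q))
      (-c * (density S x * MvPolynomial.eval x (raising S i q))) x (Pi.single i 1) := by
    refine (HasDerivAt.const_mul c (HasDerivAt.mul h1 h2)).congr_deriv ?_
    simp only [zero_smul, add_zero, evalFun_apply, raising, map_sub, map_mul, eval_precisionForm]
    ring
  exact h.lineDeriv

theorem iterate_partialDeriv_density_mul {S : Matrix (Fin N) (Fin N) ℝ} (hS : S.PosDef)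
    (i : Fin N) (n : ℕ) (c : ℝ) (q : MvPolynomial (Fin N) ℝ) :
    (partialDeriv i)^[n] (fun x => c * (density S x * MvPolynomial.eval x q)) =
      fun x => (-1) ^ n * c * (density S x * MvPolynomial.eval x ((raising S i)^[n] q)) := by
  induction n generalizing c q with
  | zero => simp
  | succ n ih =>
    rw [Function.iterate_succ_apply, partialDeriv_density_mul hS, ih, Function.iterate_succ_apply]
    ext x
    ring

theorem foldr_partialDeriv_density {S : Matrix (Fin N) (Fin N) ℝ} (hS : S.PosDef)
    (j : Fin N → ℕ) (s : List (Fin N)) :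
    s.foldr (fun i g => (partialDeriv i)^[j i] g) (density S) =
      fun x => (-1) ^ (s.map j).sum * (density S x * MvPolynomial.eval x (raisingList S j s)) := by
  induction s with
  | nil => simp [raisingList]
  | cons i s ih =>
    rw [List.foldr_cons, ih, iterate_partialDeriv_density_mul hS, List.map_cons, List.sum_cons,
      pow_add]
    rfl

/-! ### Hermite polynomials as polynomials -/

theorem density_pos {S : Matrix (Fin N) (Fin N) ℝ} (hS : S.PosDef) (x : Fin N → ℝ) :
    0 < density S x := by
  have := hS.det_pos
  unfold density
  positivity

theorem sum_map_finRange (j : Fin N → ℕ) : ((List.finRange N).map j).sum = degree j := by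
  rw [degree, Fin.sum_univ_def]

/-- The polynomial whose function is the Hermite polynomial `H_j(·; S)`. -/
def hermitePoly (S : Matrix (Fin N) (Fin N) ℝ) (j : Fin N → ℕ) : MvPolynomial (Fin N) ℝ :=
  raisingList S j (List.finRange N)

theorem hermite_eq_evalFun {S : Matrix (Fin N) (Fin N) ℝ} (hS : S.PosDef) (j : Fin N → ℕ) :
    hermite S j = evalFun (hermitePoly S j) := by
  ext x
  have h := (density_pos hS x).ne'
  rw [hermite, mixedDeriv, foldr_partialDeriv_density hS, sum_map_finRange, evalFun_apply,
    hermitePoly]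
  have h1 : ((-1 : ℝ) ^ degree j) * (-1) ^ degree j = 1 := by
    rw [← mul_pow]; simp
  field_simp
  rw [← sq] at h1
  rw [h1, one_mul]

theorem hermite_mem_polyLE {S : Matrix (Fin N) (Fin N) ℝ} (hS : S.PosDef) (j : Fin N → ℕ) :
    hermite S j ∈ polyLE N (degree j) := by
  rw [hermite_eq_evalFun hS]
  refine evalFun_mem_polyLE ?_
  rw [← sum_map_finRange]
  exact totalDegree_raisingList_le S j _

variable {S : Matrix (Fin N) (Fin N) ℝ}

/-! ### Integration by parts -/

/-- The constant 1 is a polynomial, hence in `L²`. The total mass itself is never computed: finite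
and nonzero is enough. -/
theorem isFiniteMeasure_gaussian (hS : S.PosDef) : IsFiniteMeasure (gaussian S) := by
  have h := memLp_poly hS (evalFun_mem_poly (1 : MvPolynomial (Fin N) ℝ))
  have h1 : (evalFun (1 : MvPolynomial (Fin N) ℝ)) = fun _ => (1 : ℝ) := by ext; simp
  rw [h1, memLp_const_iff (by simp) (by simp)] at h
  exact ⟨by simpa using h⟩

theorem integrable_evalFun (hS : S.PosDef) (p : MvPolynomial (Fin N) ℝ) :
    Integrable (evalFun p) (gaussian S) := by
  have := isFiniteMeasure_gaussian hS
  exact (memLp_poly hS (evalFun_mem_poly p)).integrable (by simp)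

theorem integral_gaussian (hS : S.PosDef) (f : (Fin N → ℝ) → ℝ) :
    ∫ x, f x ∂(gaussian S) = ∫ x, f x * density S x := by
  unfold gaussian
  rw [integral_withDensity_eq_integral_toReal_smul
    (continuous_density S).measurable.ennreal_ofReal (by simp)]
  refine integral_congr_ae (Filter.Eventually.of_forall fun x => ?_)
  simp [ENNReal.toReal_ofReal (density_nonneg hS x), mul_comm]

theorem integrable_evalFun_mul_density (hS : S.PosDef) (p : MvPolynomial (Fin N) ℝ) :
    Integrable fun x => evalFun p x * density S x := by
  have h := integrable_evalFun hS p
  unfold gaussian at h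
  rw [integrable_withDensity_iff (continuous_density S).measurable.ennreal_ofReal (by simp)] at h
  simpa only [ENNReal.toReal_ofReal (density_nonneg hS _)] using h

/-- Integration by parts against `φ`. No boundary term appears because a polynomial times `φ` is
integrable. -/
theorem integral_pderiv (hS : S.PosDef) (i : Fin N) (p : MvPolynomial (Fin N) ℝ) :
    ∫ x, evalFun (MvPolynomial.pderiv i p) x ∂(gaussian S) =
      ∫ x, evalFun (precisionForm S i * p) x ∂(gaussian S) := by
  have e : ∀ x, evalFun p x * -((S⁻¹ *ᵥ x) i * density S x) =
      -(evalFun (precisionForm S i * p) x * density S x) := fun x => by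
    simp only [evalFun_apply, map_mul, eval_precisionForm]
    ring
  have h := integral_bilinear_hasLineDerivAt_right_eq_neg_left_of_integrable
    (μ := (volume : Measure (Fin N → ℝ))) (B := ContinuousLinearMap.mul ℝ ℝ)
    (f := evalFun p) (f' := evalFun (MvPolynomial.pderiv i p)) (g := density S)
    (g' := fun x => -((S⁻¹ *ᵥ x) i * density S x)) (v := Pi.single i 1)
    (integrable_evalFun_mul_density hS _)
    (by
      simp only [ContinuousLinearMap.mul_apply', e]
      exact (integrable_evalFun_mul_density hS _).neg)
    (integrable_evalFun_mul_density hS _) (fun x _ => hasLineDerivAt_evalFun p i x)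
    (fun x _ => hasLineDerivAt_density hS i x)
  simp only [ContinuousLinearMap.mul_apply', e, integral_neg, neg_inj] at h
  rw [integral_gaussian hS, integral_gaussian hS, h]

/-- Adjointness of `A_i` and `∂_i`: integrate the Leibniz rule for `∂_i (p q)` and apply
`integral_pderiv` to `p * q`. -/
theorem integral_mul_raising (hS : S.PosDef) (i : Fin N) (p q : MvPolynomial (Fin N) ℝ) :
    ∫ x, evalFun (p * raising S i q) x ∂(gaussian S) =
      ∫ x, evalFun (MvPolynomial.pderiv i p * q) x ∂(gaussian S) := by
  have h := integral_pderiv hS i (p * q)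
  have e1 : p * raising S i q = (precisionForm S i * (p * q) -
      MvPolynomial.pderiv i (p * q)) + MvPolynomial.pderiv i p * q := by
    rw [raising, MvPolynomial.pderiv_mul]
    ring
  rw [e1, map_add, map_sub,
    integral_add' ((integrable_evalFun hS _).sub (integrable_evalFun hS _))
    (integrable_evalFun hS _), integral_sub' (integrable_evalFun hS _) (integrable_evalFun hS _),
    h, sub_self, zero_add]

theorem integral_mul_iterate_raising (hS : S.PosDef) (i : Fin N) (n : ℕ)
    (p q : MvPolynomial (Fin N) ℝ) :
    ∫ x, evalFun (p * (raising S i)^[n] q) x ∂(gaussian S) =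
      ∫ x, evalFun ((MvPolynomial.pderiv i)^[n] p * q) x ∂(gaussian S) := by
  induction n generalizing p with
  | zero => rfl
  | succ n ih =>
    rw [Function.iterate_succ_apply', integral_mul_raising hS, ih, Function.iterate_succ_apply]

/-- Taking adjoints reverses the order, so the right fold of raising operators becomes a left fold
of derivatives and no commutation is needed. -/
theorem integral_mul_raisingList (hS : S.PosDef) (j : Fin N → ℕ) (s : List (Fin N))
    (p : MvPolynomial (Fin N) ℝ) :
    ∫ x, evalFun (p * raisingList S j s) x ∂(gaussian S) =
      ∫ x, evalFun (s.foldl (fun p i => (MvPolynomial.pderiv i)^[j i] p) p) x ∂(gaussian S) := by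
  induction s generalizing p with
  | nil => simp [raisingList]
  | cons i s ih =>
    rw [List.foldl_cons, ← ih, ← integral_mul_iterate_raising hS]
    rfl

/-! ### Biorthogonality of monomials and Hermite polynomials -/

/-- If some `j i > k i`, the truncated `k - j` is not a true difference, but the product is then 0.
-/
theorem integral_monomial_mul_hermite (hS : S.PosDef) (j k : Fin N → ℕ) :
    ∫ x, monomial k x * hermite S j x ∂(gaussian S) =
      (∏ i, ((k i).descFactorial (j i) : ℝ)) *
        ∫ x, monomial (k - j) x ∂(gaussian S) := by
  have h := integral_mul_raisingList hS j (List.finRange N)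
    (MvPolynomial.monomial (Finsupp.equivFunOnFinite.symm k) 1)
  rw [foldl_pderiv_monomial j _ (List.nodup_finRange N), ← Fin.sum_univ_def,
    ← Fin.prod_univ_def, evalFun_monomial] at h
  have e1 : (⇑(Finsupp.equivFunOnFinite.symm k - ∑ i, Finsupp.single i (j i)) : Fin N → ℕ)
      = k - j := by
    ext a
    simp [Finsupp.single_apply]
  rw [e1] at h
  rw [hermite_eq_evalFun hS]
  simp only [evalFun_apply, map_mul, Pi.smul_apply, smul_eq_mul, one_mul, integral_const_mul] at h
  rw [hermitePoly]
  simp only [evalFun_apply]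
  rw [show (fun x => monomial k x * MvPolynomial.eval x (raisingList S j (List.finRange N))) =
    fun x => MvPolynomial.eval x
      (MvPolynomial.monomial (Finsupp.equivFunOnFinite.symm k) (1 : ℝ)) *
      MvPolynomial.eval x (raisingList S j (List.finRange N)) from ?_, h]
  · rfl
  · ext x
    have := congrFun (evalFun_monomial (Finsupp.equivFunOnFinite.symm k) 1) x
    simp only [evalFun_apply] at this
    rw [this]
    simp

theorem integral_monomial_mul_hermite_eq_zero (hS : S.PosDef) {j k : Fin N → ℕ}
    (hd : degree k ≤ degree j) (hjk : k ≠ j) :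
    ∫ x, monomial k x * hermite S j x ∂(gaussian S) = 0 := by
  -- Otherwise `j ≤ k` coordinatewise, and `|k| ≤ |j|` forces `k = j`.
  obtain ⟨i, hi⟩ : ∃ i, k i < j i := by
    by_contra! h
    refine hjk (funext fun i => le_antisymm ?_ (h i))
    have := (Finset.sum_eq_sum_iff_of_le fun i (_ : i ∈ Finset.univ) => h i).1
      (le_antisymm (Finset.sum_le_sum fun i _ => h i) hd) i (Finset.mem_univ i)
    exact this.ge
  rw [integral_monomial_mul_hermite hS, Finset.prod_eq_zero (Finset.mem_univ i), zero_mul]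
  simp [Nat.descFactorial_eq_zero_iff_lt.2 hi]

theorem gaussian_ne_zero (hS : S.PosDef) : gaussian S ≠ 0 := by
  intro h
  have h1 := integral_gaussian hS fun _ => 1
  have h2 := integrable_evalFun_mul_density hS 1
  simp only [h, integral_zero_measure, one_mul, evalFun_apply, map_one] at h1 h2
  have h3 : (0 : ℝ) < ∫ x, density S x :=
    integral_pos_of_integrable_nonneg_nonzero (continuous_density S) h2
      (density_nonneg hS) (density_pos hS 0).ne'
  exact h3.ne h1

theorem integral_monomial_mul_hermite_self_ne_zero (hS : S.PosDef) (j : Fin N → ℕ) :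
    ∫ x, monomial j x * hermite S j x ∂(gaussian S) ≠ 0 := by
  have := isFiniteMeasure_gaussian hS
  have := NeZero.mk (gaussian_ne_zero hS)
  rw [integral_monomial_mul_hermite hS]
  refine mul_ne_zero (Finset.prod_ne_zero_iff.2 fun i _ => ?_) ?_
  · simp [Nat.descFactorial_self, Nat.factorial_ne_zero]
  · simp [monomial, measureReal_ne_zero_iff, gaussian_ne_zero hS]

/-! ### Orthogonal decomposition of polynomials -/

theorem integrable_mul (hS : S.PosDef) {f g : (Fin N → ℝ) → ℝ} (hf : f ∈ poly N)
    (hg : g ∈ poly N) : Integrable (fun x => f x * g x) (gaussian S) :=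
  (memLp_poly hS hf).integrable_mul (memLp_poly hS hg)

theorem monomial_mem_poly (j : Fin N → ℕ) : monomial j ∈ poly N :=
  Submodule.subset_span ⟨j, rfl⟩

theorem hermite_mem_poly (hS : S.PosDef) (j : Fin N → ℕ) : hermite S j ∈ poly N :=
  polyLE_le_poly _ _ (hermite_mem_polyLE hS j)

/-- The linear functional `g ↦ ∫ f g φ dx` on polynomial functions. -/
def pairing (hS : S.PosDef) (f : poly N) : poly N →ₗ[ℝ] ℝ where
  toFun g := ∫ x, (f : (Fin N → ℝ) → ℝ) x * (g : (Fin N → ℝ) → ℝ) x ∂(gaussian S)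
  map_add' g h := by
    simp only [Submodule.coe_add, Pi.add_apply, mul_add]
    exact integral_add (integrable_mul hS f.2 g.2) (integrable_mul hS f.2 h.2)
  map_smul' a g := by
    simp only [Submodule.coe_smul, Pi.smul_apply, smul_eq_mul, RingHom.id_apply, mul_left_comm _ a]
    exact integral_const_mul _ _

/-- Vanishing against all monomials of degree at most `m` is vanishing on `polyLE N m`. -/
theorem integral_mul_eq_zero_of_monomial (hS : S.PosDef) {m : ℕ} {f g : (Fin N → ℝ) → ℝ}
    (hf : f ∈ poly N)
    (h : ∀ k : Fin N → ℕ, degree k ≤ m → ∫ x, monomial k x * f x ∂(gaussian S) = 0)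
    (hg : g ∈ polyLE N m) : ∫ x, f x * g x ∂(gaussian S) = 0 := by
  unfold polyLE at hg
  have hle := polyLE_le_poly N m
  unfold polyLE at hle
  induction hg using Submodule.span_induction with
  | mem g hg =>
    obtain ⟨k, hk, rfl⟩ := hg
    simpa only [mul_comm] using h k hk
  | zero => simp
  | add g₁ g₂ h1 h2 e1 e2 =>
    simp only [Pi.add_apply, mul_add]
    rw [integral_add (integrable_mul hS hf (hle h1)) (integrable_mul hS hf (hle h2)), e1, e2,
      add_zero]
  | smul a g _ e =>
    simp only [Pi.smul_apply, smul_eq_mul, mul_left_comm _ a]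
    rw [integral_const_mul, e, mul_zero]

/-- The integrand is continuous and `φ` is positive everywhere, so `f` vanishes at every point and
not merely almost everywhere. The spans are spaces of functions, which makes this necessary. -/
theorem eq_zero_of_integral_sq (hS : S.PosDef) {f : (Fin N → ℝ) → ℝ} (hf : f ∈ poly N)
    (h : ∫ x, f x * f x ∂(gaussian S) = 0) : f = 0 := by
  obtain ⟨p, rfl⟩ := exists_evalFun_eq hf
  by_contra hne
  obtain ⟨x, hx⟩ := Function.ne_iff.1 hne
  rw [integral_gaussian hS] at h
  have hi := integrable_evalFun_mul_density hS (p * p)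
  simp only [evalFun_apply, map_mul] at hi h hx
  refine (integral_pos_of_integrable_nonneg_nonzero (x := x) ?_ hi ?_ ?_).ne' h
  · exact ((continuous_evalFun p).mul (continuous_evalFun p)).mul (continuous_density S)
  · exact fun y => mul_nonneg (mul_self_nonneg _) (density_nonneg hS y)
  · exact mul_ne_zero (mul_self_ne_zero.2 hx) (density_pos hS x).ne'

theorem finite_degree_eq (N m : ℕ) : Finite {j : Fin N → ℕ // degree j = m} := by
  refine Set.Finite.subset (Set.finite_Iic fun _ : Fin N => m) fun j hj i => ?_
  rw [← show degree j = m from hj]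
  exact Finset.single_le_sum (f := j) (fun _ _ => Nat.zero_le _) (Finset.mem_univ i)

theorem linearIndependent_hermite (hS : S.PosDef) (l : ℕ) :
    LinearIndependent ℝ fun j : {j : Fin N → ℕ // degree j = l} => hermite S j := by
  -- Integration against a monomial is a linear functional only where integrability holds, hence the
  -- passage to `poly N`.
  suffices h : LinearIndependent ℝ fun j : {j : Fin N → ℕ // degree j = l} =>
      (⟨hermite S j, hermite_mem_poly hS j⟩ : poly N) from
    h.map' (poly N).subtype (Submodule.ker_subtype _)
  rw [linearIndependent_iff']
  intro s c hc j hj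
  have h := congrArg (pairing hS ⟨monomial j, monomial_mem_poly _⟩) hc
  rw [map_sum, map_zero, Finset.sum_eq_single_of_mem j hj] at h
  · rw [map_smul, smul_eq_mul] at h
    exact (mul_eq_zero.1 h).resolve_right (integral_monomial_mul_hermite_self_ne_zero hS j)
  · intro k _ hk
    rw [map_smul, smul_eq_mul]
    refine mul_eq_zero_of_right _ (integral_monomial_mul_hermite_eq_zero hS ?_ ?_)
    · rw [j.2, k.2]
    · exact fun h => hk (Subtype.ext h.symm)

theorem hermiteSpan_le_polyLE (hS : S.PosDef) (l : ℕ) : hermiteSpan S l ≤ polyLE N l := by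
  refine Submodule.span_le.2 ?_
  rintro _ ⟨⟨j, rfl⟩, rfl⟩
  exact hermite_mem_polyLE hS j

theorem hermiteSpan_le_orthPoly (hS : S.PosDef) (l : ℕ) : hermiteSpan S l ≤ orthPoly hS l := by
  refine Submodule.span_le.2 ?_
  rintro _ ⟨⟨j, rfl⟩, rfl⟩
  refine ⟨hermite_mem_polyLE hS j, fun m hm g hg => ?_⟩
  refine integral_mul_eq_zero_of_monomial hS (hermite_mem_poly hS j) (fun k hk => ?_) hg
  refine integral_monomial_mul_hermite_eq_zero hS (by lia) ?_
  rintro rfl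
  lia

/-- One step of a Gram–Schmidt process: removing a combination of the `H_j` with `|j| = m` kills the
pairings in degree `m` and does not disturb lower degrees, to which these `H_j` are orthogonal. -/
theorem exists_hermiteSpan_sub_orthogonal (hS : S.PosDef) {m : ℕ} {f : (Fin N → ℝ) → ℝ}
    (hf : f ∈ poly N)
    (h : ∀ k : Fin N → ℕ, degree k < m → ∫ x, monomial k x * f x ∂(gaussian S) = 0) :
    ∃ g ∈ hermiteSpan S m, ∀ k : Fin N → ℕ, degree k < m + 1 →
      ∫ x, monomial k x * (f - g) x ∂(gaussian S) = 0 := by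
  have := finite_degree_eq N m
  have := Fintype.ofFinite {j : Fin N → ℕ // degree j = m}
  let H : {j : Fin N → ℕ // degree j = m} → poly N := fun j => ⟨hermite S j, hermite_mem_poly hS j⟩
  let M : (Fin N → ℕ) → poly N := fun j => ⟨monomial j, monomial_mem_poly j⟩
  -- Among the `H_k` of degree `m` only `H_j` pairs nontrivially with `x^j`, so the linear system
  -- for the coefficients is diagonal.
  let a : {j : Fin N → ℕ // degree j = m} → ℝ := fun j =>
    pairing hS (M j) ⟨f, hf⟩ / pairing hS (M j) (H j)
  let g : poly N := ∑ j, a j • H j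
  refine ⟨g, ?_, fun k hk => ?_⟩
  · rw [Submodule.coe_sum]
    exact Submodule.sum_mem _ fun j _ =>
      Submodule.smul_mem _ _ (Submodule.subset_span ⟨j, rfl⟩)
  have key : pairing hS (M k) (⟨f, hf⟩ - g) = 0 := by
    simp only [g, map_sub, map_sum, map_smul, smul_eq_mul]
    rcases Nat.lt_succ_iff_lt_or_eq.1 hk with hk' | hk'
    · rw [show pairing hS (M k) ⟨f, hf⟩ = 0 from h k hk', Finset.sum_eq_zero, sub_zero]
      intro j _
      refine mul_eq_zero_of_right _ (integral_monomial_mul_hermite_eq_zero hS ?_ ?_)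
      · rw [j.2]
        exact hk'.le
      · rintro rfl
        exact hk'.ne j.2
    · rw [Finset.sum_eq_single_of_mem ⟨k, hk'⟩ (Finset.mem_univ _)]
      · have hne : pairing hS (M k) (H ⟨k, hk'⟩) ≠ 0 :=
          integral_monomial_mul_hermite_self_ne_zero hS k
        simp only [a]
        rw [div_mul_cancel₀ _ hne, sub_self]
      · intro j _ hj
        refine mul_eq_zero_of_right _ (integral_monomial_mul_hermite_eq_zero hS ?_ ?_)
        · rw [j.2, hk']
        · rintro rfl
          exact hj rfl
  exact key

theorem orthPoly_le_hermiteSpan (hS : S.PosDef) (l : ℕ) : orthPoly hS l ≤ hermiteSpan S l := by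
  rintro f ⟨hf, hf'⟩
  have hfp := polyLE_le_poly N l hf
  obtain ⟨g, hg, h⟩ := exists_hermiteSpan_sub_orthogonal hS (m := l) hfp fun k hk => by
    simpa only [mul_comm] using hf' _ hk _ (Submodule.subset_span ⟨k, le_rfl, rfl⟩)
  have hfg : f - g ∈ polyLE N l := Submodule.sub_mem _ hf (hermiteSpan_le_polyLE hS l hg)
  have h0 := eq_zero_of_integral_sq hS (polyLE_le_poly N l hfg)
    (integral_mul_eq_zero_of_monomial hS (polyLE_le_poly N l hfg)
      (fun k hk => h k (Nat.lt_succ_of_le hk)) hfg)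
  rwa [sub_eq_zero.1 h0]

theorem hermiteSpan_eq_orthPoly (hS : S.PosDef) (l : ℕ) : hermiteSpan S l = orthPoly hS l :=
  le_antisymm (hermiteSpan_le_orthPoly hS l) (orthPoly_le_hermiteSpan hS l)

theorem integral_mul_eq_zero_of_lt (hS : S.PosDef) {k l : ℕ} (hkl : k < l)
    {f g : (Fin N → ℝ) → ℝ} (hf : f ∈ hermiteSpan S k) (hg : g ∈ hermiteSpan S l) :
    ∫ x, g x * f x ∂(gaussian S) = 0 :=
  (hermiteSpan_le_orthPoly hS l hg).2 k hkl f (hermiteSpan_le_polyLE hS k hf)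

/-- The bound `m ≤ l + 1` means that only Hermite polynomials of degree at most `l` are subtracted,
so `g` stays in `polyLE N l`. At `m = l + 1` the remainder is orthogonal to itself. -/
theorem exists_iSup_hermiteSpan_sub_orthogonal (hS : S.PosDef) {l : ℕ} {f : (Fin N → ℝ) → ℝ}
    (hf : f ∈ polyLE N l) (m : ℕ) (hm : m ≤ l + 1) :
    ∃ g ∈ ⨆ n, hermiteSpan S n, g ∈ polyLE N l ∧ ∀ k : Fin N → ℕ, degree k < m →
      ∫ x, monomial k x * (f - g) x ∂(gaussian S) = 0 := by
  induction m with
  | zero => exact ⟨0, Submodule.zero_mem _, Submodule.zero_mem _, fun k hk => by lia⟩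
  | succ m ih =>
    obtain ⟨g, hg, hgl, h⟩ := ih (by lia)
    obtain ⟨g', hg', h'⟩ := exists_hermiteSpan_sub_orthogonal hS
      (polyLE_le_poly N l (Submodule.sub_mem _ hf hgl)) h
    refine ⟨g + g', Submodule.add_mem _ hg (Submodule.mem_iSup_of_mem m hg'),
      Submodule.add_mem _ hgl (polyLE_mono (by lia) (hermiteSpan_le_polyLE hS m hg')), ?_⟩
    simpa only [sub_add_eq_sub_sub] using h'

theorem iSup_hermiteSpan (hS : S.PosDef) : ⨆ l : ℕ, hermiteSpan S l = poly N := by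
  refine le_antisymm
    (iSup_le fun l => (hermiteSpan_le_polyLE hS l).trans (polyLE_le_poly N l)) fun f hf => ?_
  obtain ⟨l, hl⟩ := exists_mem_polyLE hf
  obtain ⟨g, hg, hgl, h⟩ := exists_iSup_hermiteSpan_sub_orthogonal hS hl (l + 1) le_rfl
  have hfg : f - g ∈ polyLE N l := Submodule.sub_mem _ hl hgl
  have h0 := eq_zero_of_integral_sq hS (polyLE_le_poly N l hfg)
    (integral_mul_eq_zero_of_monomial hS (polyLE_le_poly N l hfg)
      (fun k hk => h k (Nat.lt_succ_of_le hk)) hfg)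
  rwa [sub_eq_zero.1 h0]

/-! ### Density of polynomials in `L²` -/

theorem memLp_exp_abs (hS : S.PosDef) (L : StrongDual ℝ (Fin N → ℝ)) :
    MemLp (fun x => Real.exp |L x|) 2 (gaussian S) := by
  have hcont : Continuous fun x => Real.exp |L x| := by fun_prop
  rw [memLp_two_iff_integrable_sq hcont.aestronglyMeasurable]
  unfold gaussian
  rw [integrable_withDensity_iff (continuous_density S).measurable.ennreal_ofReal (by simp)]
  simp only [ENNReal.toReal_ofReal (density_nonneg hS _)]
  obtain ⟨c, hc, hq⟩ := quadForm_lower hS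
  have hdet := hS.det_pos
  set K : ℝ := (2 * Real.pi) ^ (-(N : ℝ) / 2) * S.det ^ (-(1 : ℝ) / 2) with hK
  have hK0 : 0 ≤ K := by positivity
  -- The density decays at least like `exp (-(c/2) ∑ x_i²)`. Half of this decay absorbs `exp (2 |L
  -- x|)` at the cost of the constant `exp (4 ‖L‖² / c)`, and `c / 4` remains.
  have h1 : Integrable fun x : Fin N → ℝ =>
      (K * Real.exp (4 * ‖L‖ ^ 2 / c)) * ∏ i, Real.exp (-(c / 4) * x i ^ 2) :=
    (Integrable.fintype_prod (f := fun _ (t : ℝ) => Real.exp (-(c / 4) * t ^ 2))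
      fun _ => integrable_exp_neg_mul_sq (by positivity)).const_mul _
  refine h1.mono' ((hcont.pow 2).mul (continuous_density S)).aestronglyMeasurable
    (Filter.Eventually.of_forall fun x => ?_)
  rw [Real.norm_of_nonneg (mul_nonneg (sq_nonneg _) (density_nonneg hS x)), ← Real.exp_sum,
    ← Finset.mul_sum, ← Real.exp_nat_mul, mul_assoc K, ← Real.exp_add, density, ← hK,
    mul_left_comm, ← Real.exp_add]
  refine mul_le_mul_of_nonneg_left (Real.exp_le_exp.2 ?_) hK0
  have h2 : |L x| ≤ ‖L‖ * ‖x‖ := by simpa using L.le_opNorm x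
  -- The norm here is the sup norm.
  have h3 : ‖x‖ ^ 2 ≤ ∑ i, x i ^ 2 := by
    have h0 : 0 ≤ ∑ i, x i ^ 2 := Finset.sum_nonneg fun i _ => sq_nonneg _
    refine (Real.le_sqrt (norm_nonneg x) h0).1 ((pi_norm_le_iff_of_nonneg (Real.sqrt_nonneg _)).2
      fun i => Real.abs_le_sqrt ?_)
    exact Finset.single_le_sum (f := fun i => x i ^ 2) (fun _ _ => sq_nonneg _)
      (Finset.mem_univ i)
  have h4 : 2 * (‖L‖ * ‖x‖) ≤ 4 * ‖L‖ ^ 2 / c + c / 4 * ‖x‖ ^ 2 := by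
    have : 4 * ‖L‖ ^ 2 / c + c / 4 * ‖x‖ ^ 2 - 2 * (‖L‖ * ‖x‖) =
        (2 * ‖L‖ - c / 2 * ‖x‖) ^ 2 / c := by
      field_simp
      ring
    have : 0 ≤ (2 * ‖L‖ - c / 2 * ‖x‖) ^ 2 / c := by positivity
    linarith
  have h5 : c / 4 * ‖x‖ ^ 2 ≤ c / 4 * ∑ i, x i ^ 2 := by gcongr
  have := hq x
  push_cast
  linarith

theorem pow_dual_mem_poly (L : StrongDual ℝ (Fin N → ℝ)) (n : ℕ) : (fun x => L x ^ n) ∈ poly N := by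
  have h : (fun x => L x ^ n) = evalFun ((∑ i, MvPolynomial.C (L (Pi.single i 1)) *
      MvPolynomial.X i) ^ n) := by
    ext x
    simp only [evalFun_apply, map_pow, map_sum, map_mul, MvPolynomial.eval_C, MvPolynomial.eval_X]
    congr 1
    conv_lhs => rw [pi_eq_sum_univ' x]
    simp [mul_comm]
  rw [h]
  exact evalFun_mem_poly _

/-- Each term of the exponential series is a polynomial times `f`, with integral 0. The sum of the
absolute values is `exp |L x| * |f x|`, integrable as a product of two `L²` functions, so dominated
convergence applies. -/
theorem integral_cexp_mul_eq_zero (hS : S.PosDef) {f : (Fin N → ℝ) → ℝ}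
    (hf : MemLp f 2 (gaussian S)) (h : ∀ g ∈ poly N, ∫ x, g x * f x ∂(gaussian S) = 0)
    (L : StrongDual ℝ (Fin N → ℝ)) :
    ∫ x, Complex.exp (L x * Complex.I) * f x ∂(gaussian S) = 0 := by
  have hF : ∀ (n : ℕ) (x : Fin N → ℝ), (L x * Complex.I) ^ n / n.factorial * f x =
      (Complex.I ^ n / n.factorial) * ((L x ^ n * f x : ℝ) : ℂ) := fun n x => by
    push_cast
    ring
  have hs := hasSum_integral_of_dominated_convergence (μ := gaussian S)
    (F := fun (n : ℕ) x => (L x * Complex.I) ^ n / n.factorial * f x)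
    (f := fun x => Complex.exp (L x * Complex.I) * f x)
    (fun n x => |L x| ^ n / n.factorial * |f x|) ?_ ?_ ?_ ?_ ?_
  · refine hs.unique ?_
    convert hasSum_zero with n
    simp only [hF]
    rw [integral_const_mul, integral_complex_ofReal, h _ (pow_dual_mem_poly L n)]
    simp
  · intro n
    refine AEStronglyMeasurable.mul ?_
      (Complex.continuous_ofReal.comp_aestronglyMeasurable hf.aestronglyMeasurable)
    exact Continuous.aestronglyMeasurable (by fun_prop)
  · exact fun n => Filter.Eventually.of_forall fun x => by simp
  · exact Filter.Eventually.of_forall fun x =>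
      (Real.summable_pow_div_factorial |L x|).mul_right _
  · refine ((memLp_exp_abs hS L).integrable_mul hf.abs).congr
      (Filter.Eventually.of_forall fun x => ?_)
    simp only [Pi.mul_apply, tsum_mul_right]
    rw [Real.exp_eq_exp_ℝ, NormedSpace.exp_eq_tsum_div]
    rfl
  · refine Filter.Eventually.of_forall fun x => HasSum.mul_right _ ?_
    rw [Complex.exp_eq_exp_ℂ]
    exact NormedSpace.expSeries_div_hasSum_exp _

/-- `ENNReal.ofReal` truncates at 0, so the measure has density `max f 0`. Applied to `f` and to
`-f`, this covers both parts of `f`. -/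
theorem charFunDual_withDensity {f : (Fin N → ℝ) → ℝ}
    (hf : MemLp f 2 (gaussian S)) (L : StrongDual ℝ (Fin N → ℝ)) :
    charFunDual ((gaussian S).withDensity fun x => ENNReal.ofReal (f x)) L =
      ∫ x, Complex.exp (L x * Complex.I) * (max (f x) 0 : ℝ) ∂(gaussian S) := by
  rw [charFunDual_apply, integral_withDensity_eq_integral_toReal_smul₀
    hf.aestronglyMeasurable.aemeasurable.ennreal_ofReal (by simp)]
  refine integral_congr_ae (Filter.Eventually.of_forall fun x => ?_)
  simp [ENNReal.toReal_ofReal', mul_comm]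

theorem ae_eq_zero_of_orthogonal_poly (hS : S.PosDef) {f : (Fin N → ℝ) → ℝ}
    (hf : MemLp f 2 (gaussian S)) (h : ∀ g ∈ poly N, ∫ x, g x * f x ∂(gaussian S) = 0) :
    f =ᵐ[gaussian S] 0 := by
  have := isFiniteMeasure_gaussian hS
  have hi : Integrable f (gaussian S) := hf.integrable (by simp)
  have hi' : Integrable (fun x => -f x) (gaussian S) := hi.neg
  have := isFiniteMeasure_withDensity_ofReal hi.2
  have := isFiniteMeasure_withDensity_ofReal hi'.2
  have hint : ∀ (L : StrongDual ℝ (Fin N → ℝ)) (g : (Fin N → ℝ) → ℝ), Integrable g (gaussian S) →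
      Integrable (fun x => Complex.exp (L x * Complex.I) * (max (g x) 0 : ℝ)) (gaussian S) :=
    fun L g hg => by
      refine hg.pos_part.ofReal.bdd_mul (c := 1)
        (Continuous.aestronglyMeasurable (by fun_prop)) (Filter.Eventually.of_forall fun x => ?_)
      rw [Complex.norm_exp_ofReal_mul_I]
  -- The difference of the two characteristic functions at `L` is `∫ exp (i L x) f`, since `max f 0
  -- - max (-f) 0 = f`.
  have heq : (gaussian S).withDensity (fun x => ENNReal.ofReal (f x)) =
      (gaussian S).withDensity (fun x => ENNReal.ofReal (-f x)) := by
    refine Measure.ext_of_charFunDual (funext fun L => ?_)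
    have hf' : MemLp (fun x => -f x) 2 (gaussian S) := hf.neg
    rw [charFunDual_withDensity hf, charFunDual_withDensity hf', ← sub_eq_zero,
      ← integral_sub (hint L f hi) (hint L _ hi'), ← integral_cexp_mul_eq_zero hS hf h L]
    refine integral_congr_ae (Filter.Eventually.of_forall fun x => ?_)
    simp only [← mul_sub, ← Complex.ofReal_sub]
    congr 2
    rcases le_total (f x) 0 with h0 | h0
    · rw [max_eq_right h0, max_eq_left (by linarith)]
      ring
    · rw [max_eq_left h0, max_eq_right (by linarith)]
      ring
  have hm := hf.aestronglyMeasurable.aemeasurable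
  rw [withDensity_eq_iff hm.ennreal_ofReal hi'.aemeasurable.ennreal_ofReal
    hi.lintegral_lt_top.ne] at heq
  filter_upwards [heq] with x hx
  rcases lt_trichotomy (f x) 0 with h0 | h0 | h0
  · rw [ENNReal.ofReal_of_nonpos h0.le] at hx
    have := ENNReal.ofReal_eq_zero.1 hx.symm
    linarith
  · exact h0
  · have h1 : ENNReal.ofReal (-f x) = 0 := ENNReal.ofReal_of_nonpos (by linarith)
    have := ENNReal.ofReal_eq_zero.1 (hx.trans h1)
    linarith

/-- In a Hilbert space a subspace is dense as soon as its orthogonal complement is trivial. -/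
theorem dense_l2Classes_poly (hS : S.PosDef) :
    Dense (l2Classes S (poly N) : Set (Lp ℝ 2 (gaussian S))) := by
  rw [Submodule.dense_iff_topologicalClosure_eq_top, Submodule.topologicalClosure_eq_top_iff,
    Submodule.eq_bot_iff]
  intro F hF
  rw [Lp.eq_zero_iff_ae_eq_zero]
  refine ae_eq_zero_of_orthogonal_poly hS (Lp.memLp F) fun g hg => ?_
  have hgL := memLp_poly hS hg
  have h := (Submodule.mem_orthogonal _ _).1 hF (hgL.toLp g) ⟨g, hg, hgL.coeFn_toLp⟩
  rw [L2.inner_def] at h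
  rw [← h]
  refine integral_congr_ae ?_
  filter_upwards [hgL.coeFn_toLp] with x hx
  rw [hx]
  simp [mul_comm]

end GaussianHermite

end

open GaussianHermite in
theorem proposition13 (N : ℕ) (S : Matrix (Fin N) (Fin N) ℝ) (hS : S.PosDef) :
    -- for every `l`, the Hermite polynomials of degree `l` form a basis of the space of
    -- orthogonal polynomials of degree `l`
    (∀ l : ℕ,
      LinearIndependent ℝ (fun j : {j : Fin N → ℕ // degree j = l} => hermite S j) ∧
      hermiteSpan S l = orthPoly hS l) ∧
    -- their spans are mutually orthogonal, with sum the space of all polynomials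
    (∀ k l : ℕ, k ≠ l → ∀ f ∈ hermiteSpan S k, ∀ g ∈ hermiteSpan S l,
      ∫ x, f x * g x ∂(gaussian S) = 0) ∧
    (⨆ l : ℕ, hermiteSpan S l) = poly N ∧
    -- the orthogonal sum of these spans is dense in `L²`
    Dense (l2Classes S (⨆ l : ℕ, hermiteSpan S l) : Set (Lp ℝ 2 (gaussian S))) ∧
    -- `L²` is the closure of the orthogonal sum of the spaces of orthogonal polynomials
    closure (l2Classes S (⨆ l : ℕ, orthPoly hS l) : Set (Lp ℝ 2 (gaussian S))) = Set.univ := by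
  refine ⟨fun l => ⟨linearIndependent_hermite hS l, hermiteSpan_eq_orthPoly hS l⟩,
    fun k l hkl f hf g hg => ?_, iSup_hermiteSpan hS, ?_, ?_⟩
  · rcases hkl.lt_or_gt with h | h
    · simpa only [mul_comm] using integral_mul_eq_zero_of_lt hS h hf hg
    · exact integral_mul_eq_zero_of_lt hS h hg hf
  · rw [iSup_hermiteSpan hS]
    exact dense_l2Classes_poly hS
  · simp only [← hermiteSpan_eq_orthPoly hS, iSup_hermiteSpan hS]
    exact (dense_l2Classes_poly hS).closure_eq
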